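/- Let $(\mathcal X,\mathcal A,P,r,\gamma)$ be a discounted Markov decision process: the state space $\mathcal X$ and the action space $\mathcal A$ are measurable spaces, the $\sigma$-algebra of $\mathcal A$ being countably generated (for instance, Borel subsets of Euclidean spaces), $P$ is a probability kernel from $\mathcal X\times\mathcal A$ to $\mathcal X$, the reward $r:\mathcal X\times\mathcal A\to\mathbb R$ is bounded and measurable, and $0\le\gamma<1$. Let $\pi$ (the policy) and $\pi^{\mathrm{ref}}$ (the reference policy) be probability kernels from $\mathcal X$ to $\mathcal A$, and let $\mathrm{KL}^\pi(x):=\mathrm{KL}(\pi_x\,\|\,\pi^{\mathrm{ref}}_x)\in[0,\infty]$. Let $P^\pi_{x,a}$ be the law of $(X',A')$ when $X'\sim P_{x,a}$ and, given $X'$, $A'\sim\pi_{X'}$. For $p\in[1,\infty)$ let $\mathcal K_p$ be the set of probability kernels $\zeta$ from $\mathcal X\times\mathcal A$ to $\mathbb R$ with $\sup_{x,a}\int|z|^p\,d\zeta_{x,a}(z)<\infty$, and let $\bar w_p(\zeta,\zeta'):=\sup_{x,a}w_p(\zeta_{x,a},\zeta'_{x,a})$, where $w_p$ is the $p$-Wasserstein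 distance on $\mathbb R$. For $\tau\ge 0$ the soft distributional Bellman operator $\mathcal T^\pi_\tau$ sends a probability kernel $\zeta$ to the kernel whose value $(\mathcal T^\pi_\tau\zeta)_{x,a}$ is the law of $$r(x,a)+\gamma Z-\gamma\tau\,\mathrm{KL}^\pi(X'),\qquad (X',A')\sim P^\pi_{x,a},\quad Z\mid(X',A')\sim\zeta_{X',A'} .$$ (Under the condition imposed next, $\tau\,\mathrm{KL}^\pi(X')$ is almost surely finite.) Let $p\in[1,\infty)$ and $\tau\ge0$ be such that $$\sup_{x,a}\big\|\tau\,\mathrm{KL}^\pi\big\|_{L^p(P_{x,a})}<\infty ,$$ with the convention $0\cdot\infty=0$ here and above (so the condition is void for $\tau=0$). Then: 1. $\mathcal T^\pi_\tau$ maps $\mathcal K_p$ to itself and is a $\gamma$-contraction in $\bar w_p$: $\bar w_p(\mathcal T^\pi_\tau\zeta,\mathcal T^\pi_\tau\zeta')\le\gamma\,\bar w_p(\zeta,\zeta')$ for all $\zeta,\zeta'\in\mathcal K_p$. 2. Let $(X_t,A_t)_{t\ge0}$ be the Markov chain with transition kernel $P^\pi$ started at $(X_0,A_0)=(x,a)$.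 For every $(x,a)$ the series $\sum_{t\ge1}\gamma^t\big(r(X_t,A_t)-\tau\,\mathrm{KL}^\pi(X_t)\big)$ converges absolutely almost surely, and the soft return distribution $$\zeta^{\pi}_{\tau}(x,a):=\mathrm{Law}\Big(r(X_0,A_0)+\sum_{t\ge1}\gamma^t\big(r(X_t,A_t)-\tau\,\mathrm{KL}^\pi(X_t)\big)\,\Big|\,X_0=x,\,A_0=a\Big)$$ belongs to $\mathcal K_p$ and is the unique $\zeta\in\mathcal K_p$ with $\mathcal T^\pi_\tau\zeta=\zeta$. -/

import Mathlib

open MeasureTheory ProbabilityTheory InformationTheory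
open scoped ENNReal

noncomputable section

/-! ### Kernels with bounded moments and the supremal Wasserstein metric -/

/-- The couplings of two measures on `ℝ`: measures on `ℝ × ℝ` with the given marginals. -/
def couplings (μ ν : Measure ℝ) : Set (Measure (ℝ × ℝ)) :=
  {ρ | ρ.map Prod.fst = μ ∧ ρ.map Prod.snd = ν}

/-- The `p`-Wasserstein distance of two probability measures on `ℝ`. -/
def wasserstein (p : ℝ) (μ ν : Measure ℝ) : ℝ≥0∞ :=
  (⨅ ρ ∈ couplings μ ν, ∫⁻ z, edist z.1 z.2 ^ p ∂ρ) ^ (1 / p)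

/-- The probability kernels `ζ` from `Y` to `ℝ` with `sup_y ∫ |z|^p dζ_y(z) < ∞`. -/
def momentKernels (Y : Type*) [MeasurableSpace Y] (p : ℝ) : Set (Kernel Y ℝ) :=
  {ζ | IsMarkovKernel ζ ∧ ⨆ y, ∫⁻ z, ‖z‖ₑ ^ p ∂(ζ y) < ∞}

/-- The supremal Wasserstein metric `sup_y W_p(ζ_y, ζ'_y)`. -/
def supWasserstein {Y : Type*} [MeasurableSpace Y] (p : ℝ) (ζ ζ' : Kernel Y ℝ) : ℝ≥0∞ :=
  ⨆ y, wasserstein p (ζ y) (ζ' y)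

/-! ### The decision process -/

/-- A Markov decision process with state space `X`, action space `A`, transition kernel `P`,
measurable reward `r` and discount factor `γ`. -/
structure DecisionProcess (X A : Type*) [MeasurableSpace X] [MeasurableSpace A] where
  P : Kernel (X × A) X
  isMarkovKernel_P : IsMarkovKernel P
  r : X × A → ℝ
  measurable_r : Measurable r
  γ : ℝ

attribute [instance] DecisionProcess.isMarkovKernel_P

/-- The Kullback-Leibler penalty `x ↦ KL(π_x ‖ πref_x)`, as an extended nonnegative function. -/
def klPenalty {X A : Type*} [MeasurableSpace X] [MeasurableSpace A] (π πref : Kernel X A)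
    (x : X) : ℝ≥0∞ :=
  klDiv (π x) (πref x)

theorem measurable_klPenalty {X A : Type*} [MeasurableSpace X] [MeasurableSpace A]
    [MeasurableSpace.CountablyGenerated A] (π πref : Kernel X A)
    [IsMarkovKernel π] [IsMarkovKernel πref] : Measurable (klPenalty π πref) := by
  classical
  have h : klPenalty π πref = fun x => if π x ≪ πref x then
      ∫⁻ a, ENNReal.ofReal (klFun (Kernel.rnDeriv π πref x a).toReal) ∂(πref x) else ∞ := by
    funext x
    rw [klPenalty, klDiv_eq_lintegral_klFun]
    congr 1
    apply lintegral_congr_ae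
    filter_upwards [Kernel.rnDeriv_eq_rnDeriv_measure (κ := π) (η := πref) (a := x)] with a ha
    rw [ha]
  rw [h]
  refine Measurable.ite (Kernel.measurableSet_absolutelyContinuous π πref) ?_ measurable_const
  refine Measurable.lintegral_kernel_prod_right
    (f := fun x a => ENNReal.ofReal (klFun (Kernel.rnDeriv π πref x a).toReal)) ?_
  exact (measurable_klFun.comp (Kernel.measurable_rnDeriv π πref).ennreal_toReal).ennreal_ofReal

namespace DecisionProcess

variable {X A : Type*} [MeasurableSpace X] [MeasurableSpace A]

/-- The state-action transition kernel of a policy `π`: from `(x, a)`, draw the next state `x'`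
from `P_{x,a}`, then the next action `a'` from `π_{x'}`. -/
def stateActionKernel (M : DecisionProcess X A) (π : Kernel X A) : Kernel (X × A) (X × A) :=
  M.P ⊗ₖ Kernel.prodMkLeft (X × A) π

instance (M : DecisionProcess X A) (π : Kernel X A) [IsMarkovKernel π] :
    IsMarkovKernel (M.stateActionKernel π) := by
  unfold stateActionKernel; infer_instance

/-- The law, on `ℕ → X × A`, of the state-action process `(X_t, A_t)_{t ≥ 0}` of the policy `π`
started at `(X_0, A_0) = (x, a)`: the Markov chain with kernel `stateActionKernel`. -/
def trajectory (M : DecisionProcess X A) (π : Kernel X A) [IsMarkovKernel π] :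
    Kernel (X × A) (ℕ → X × A) :=
  (Kernel.traj (X := fun _ => X × A)
    (fun n => (M.stateActionKernel π).comap
      (fun h : (i : Finset.Iic n) → X × A => h ⟨n, Finset.mem_Iic.2 le_rfl⟩)
      (measurable_pi_apply _)) 0).comap
    (fun xa _ => xa) (measurable_pi_lambda _ fun _ => measurable_id)

variable [MeasurableSpace.CountablyGenerated A]

/-- The soft distributional Bellman operator: `(T ζ)_{x,a}` is the law of
`r(x, a) + γ Z - γ τ KL(π_{X'} ‖ πref_{X'})`, where `(X', A')` is drawn from the state-action
kernel at `(x, a)` and then `Z` from `ζ_{X', A'}`. -/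
def softBellman (M : DecisionProcess X A) (π πref : Kernel X A) [IsMarkovKernel π]
    [IsMarkovKernel πref] (τ : ℝ) (ζ : Kernel (X × A) ℝ) : Kernel (X × A) ℝ where
  toFun xa :=
    ((M.stateActionKernel π ⊗ₖ Kernel.prodMkLeft (X × A) ζ) xa).map
      (fun y : (X × A) × ℝ =>
        M.r xa + M.γ * y.2 - M.γ * τ * (klPenalty π πref y.1.1).toReal)
  measurable' := by
    have hkl := measurable_klPenalty π πref
    have hr := M.measurable_r
    have hg : Measurable (fun w : (X × A) × ((X × A) × ℝ) =>
        M.r w.1 + M.γ * w.2.2 - M.γ * τ * (klPenalty π πref w.2.1.1).toReal) := by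
      fun_prop
    refine Measure.measurable_of_measurable_coe _ fun s hs => ?_
    have key := Kernel.measurable_kernel_prodMk_left
      (κ := M.stateActionKernel π ⊗ₖ Kernel.prodMkLeft (X × A) ζ) (hg hs)
    convert! key using 2 with xa
    exact Measure.map_apply (hg.comp measurable_prodMk_left) hs

/-- The term `γ^(t+1) (r(X_{t+1}, A_{t+1}) - τ KL(π_{X_{t+1}} ‖ πref_{X_{t+1}}))` of the soft
return along a trajectory `ω`. -/
def softReturnTerm (M : DecisionProcess X A) (π πref : Kernel X A) (τ : ℝ) (ω : ℕ → X × A)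
    (t : ℕ) : ℝ :=
  M.γ ^ (t + 1) * (M.r (ω (t + 1)) - τ * (klPenalty π πref (ω (t + 1)).1).toReal)

/-- The soft return along a trajectory `ω`; the penalty is not charged at time `0`. -/
def softReturn (M : DecisionProcess X A) (π πref : Kernel X A) (τ : ℝ) (ω : ℕ → X × A) : ℝ :=
  M.r (ω 0) + ∑' t, M.softReturnTerm π πref τ ω t

/-- The next definition pushes a kernel forward by `softReturn`, which requires measurability. -/
theorem measurable_softReturn (M : DecisionProcess X A) (π πref : Kernel X A)
    [IsMarkovKernel π] [IsMarkovKernel πref] (τ : ℝ) :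
    Measurable (M.softReturn π πref τ) := by
  have hkl := measurable_klPenalty π πref
  have hr := M.measurable_r
  unfold softReturn softReturnTerm
  refine (by fun_prop : Measurable fun ω : ℕ → X × A => M.r (ω 0)).add (Measurable.tsum ?_)
  intro t
  fun_prop

/-- The soft return distribution function: the conditional law of the soft return given
`(X_0, A_0) = (x, a)`. -/
def softReturnDistribution (M : DecisionProcess X A) (π πref : Kernel X A) [IsMarkovKernel π]
    [IsMarkovKernel πref] (τ : ℝ) : Kernel (X × A) ℝ :=
  (M.trajectory π).map (M.softReturn π πref τ)

end DecisionProcess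

end

/-! The contraction rests on the quantile representation of `wasserstein` on the line,
`wasserstein_rpow_eq`. Draw `(X', A')` once together with an independent uniform `U`, and feed the
quantiles of `ζ` and `ζ'` at `(X', A')`, both evaluated at `U`, into the Bellman update. This
couples the two images. The reward and the penalty cancel in the difference, which leaves `γ` times
the distance of the quantiles; its `p`-th power, integrated over `U`, is `γ^p` times the `p`-th
power of the Wasserstein distance at `(X', A')`, at most the supremum. Since quantiles are jointly
measurable in the kernel's parameter and the level, no measurable selection of optimal couplings is
required.

That the quantile coupling is optimal follows by writing `|x - y|^p` as a mixture of indicators of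
the events that a level, or a gap between two levels, separates `x` from `y`
(`exists_edist_rpow_eq_lintegral`); the quantile coupling minimizes the probability of each such
event (`quantileCoupling_separatedPairs_le`).

Existence of the fixed point uses no completeness: the soft return distribution is a fixed point by
the Markov property at time 1 (`trajectory_map_shift`) and the recursion `softReturn_eq_shift`. Its
moments are bounded by Minkowski and Fatou with geometric weights. Uniqueness holds because a finite
distance bounded by `γ < 1` times itself vanishes. -/

noncomputable section

/-! ### Quantile functions -/

/-- The uniform distribution on the unit interval. -/
def unitUniform : Measure ℝ := volume.restrict (Set.Ioo 0 1)

instance : IsProbabilityMeasure unitUniform := ⟨by simp [unitUniform]⟩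

open Classical in
/-- The quantile function of a measure on `ℝ`, extended by `0` outside of `(0, 1)`. -/
def quantile (μ : Measure ℝ) (t : ℝ) : ℝ :=
  if t ∈ Set.Ioo (0 : ℝ) 1 then sInf {x | t ≤ cdf μ x} else 0

/-- The limits of the cdf at both ends make the infimum a real one, and right-continuity makes it
attained. Every later fact about quantiles goes through this Galois connection. -/
theorem quantile_le_iff (μ : Measure ℝ) {t : ℝ} (ht : t ∈ Set.Ioo (0 : ℝ) 1) (x : ℝ) :
    quantile μ t ≤ x ↔ t ≤ cdf μ x := by
  have hne : {x | t ≤ cdf μ x}.Nonempty :=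
    ((tendsto_cdf_atTop μ).eventually (lt_mem_nhds ht.2)).exists.imp fun x hx => hx.le
  have hbdd : BddBelow {x | t ≤ cdf μ x} := by
    obtain ⟨b, hb⟩ := ((tendsto_cdf_atBot μ).eventually (gt_mem_nhds ht.1)).exists
    refine ⟨b, fun y (hy : t ≤ cdf μ y) => ?_⟩
    by_contra! hlt
    exact absurd (hy.trans (monotone_cdf μ hlt.le)) (not_le.2 hb)
  rw [quantile, if_pos ht]
  constructor
  · intro h
    refine ge_of_tendsto (((cdf μ).right_continuous x).tendsto.mono_left
      (nhdsWithin_mono x Set.Ioi_subset_Ici_self)) ?_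
    filter_upwards [self_mem_nhdsWithin] with y hy
    obtain ⟨z, hz, hzy⟩ := exists_lt_of_csInf_lt hne (h.trans_lt hy)
    exact le_trans hz (monotone_cdf μ hzy.le)
  · exact fun h => csInf_le hbdd h

theorem quantile_of_notMem (μ : Measure ℝ) {t : ℝ} (ht : t ∉ Set.Ioo (0 : ℝ) 1) :
    quantile μ t = 0 := if_neg ht

/-- Joint measurability is what lets a single uniform variable drive the optimal couplings at all
parameters simultaneously. -/
theorem measurable_quantile_kernel {Y : Type*} [MeasurableSpace Y] (ζ : Kernel Y ℝ)
    [IsMarkovKernel ζ] : Measurable fun w : Y × ℝ => quantile (ζ w.1) w.2 := by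
  refine measurable_of_Iic fun x => ?_
  have h : (fun w : Y × ℝ => quantile (ζ w.1) w.2) ⁻¹' Set.Iic x =
      ({w | w.2 ∈ Set.Ioo (0 : ℝ) 1} ∩ {w | w.2 ≤ (ζ w.1 (Set.Iic x)).toReal}) ∪
        ({w | w.2 ∈ Set.Ioo (0 : ℝ) 1}ᶜ ∩ {_w | 0 ≤ x}) := by
    ext w
    by_cases hw : w.2 ∈ Set.Ioo (0 : ℝ) 1
    · simp only [Set.mem_preimage, Set.mem_Iic, quantile_le_iff _ hw, cdf_eq_real]
      simp [Measure.real]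
      grind
    · simp only [Set.mem_preimage, Set.mem_Iic, quantile_of_notMem _ hw]
      simp
      grind
  rw [h]
  have h1 : MeasurableSet {w : Y × ℝ | w.2 ∈ Set.Ioo (0 : ℝ) 1} :=
    measurable_snd measurableSet_Ioo
  refine (h1.inter (measurableSet_le measurable_snd ?_)).union
    (h1.compl.inter (MeasurableSet.const _))
  exact ((Kernel.measurable_coe ζ measurableSet_Iic).comp measurable_fst).ennreal_toReal

theorem measurable_quantile (μ : Measure ℝ) [IsProbabilityMeasure μ] :
    Measurable (quantile μ) :=
  (measurable_quantile_kernel (Kernel.const Unit μ)).comp (measurable_prodMk_left (x := ()))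

/-- Inverse transform sampling: within the unit interval, the levels whose quantile is at most `x`
form an interval of length `cdf μ x`. -/
theorem map_quantile (μ : Measure ℝ) [IsProbabilityMeasure μ] :
    unitUniform.map (quantile μ) = μ := by
  have := Measure.isProbabilityMeasure_map (μ := unitUniform) (measurable_quantile μ).aemeasurable
  refine Measure.ext_of_Iic _ _ fun x => ?_
  rw [Measure.map_apply (measurable_quantile μ) measurableSet_Iic, unitUniform,
    Measure.restrict_apply (measurable_quantile μ measurableSet_Iic)]
  have h : quantile μ ⁻¹' Set.Iic x ∩ Set.Ioo 0 1 = Set.Iic (cdf μ x) ∩ Set.Ioo 0 1 := by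
    ext t
    simp only [Set.mem_inter_iff, Set.mem_preimage, Set.mem_Iic]
    exact and_congr_left fun ht => quantile_le_iff μ ht x
  rw [h, ← Measure.restrict_apply measurableSet_Iic, restrict_Ioo_eq_restrict_Ioc,
    Measure.restrict_apply measurableSet_Iic]
  have h' : Set.Iic (cdf μ x) ∩ Set.Ioc 0 1 = Set.Ioc 0 (cdf μ x) := by
    ext t
    have := cdf_le_one μ x
    simp only [Set.mem_inter_iff, Set.mem_Iic, Set.mem_Ioc]
    grind
  rw [h', Real.volume_Ioc, sub_zero, ofReal_cdf]

/-! ### Optimality of the quantile coupling -/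

/-- Taylor's formula with integral remainder for the convex function `z ^ p`: `ν` is its second
derivative. For `p = 1` this is the point mass at the kink `0`; for `p > 1` it has the density `p (p
- 1) s ^ (p - 2)`. -/
theorem exists_lintegral_ofReal_sub_eq_rpow {p : ℝ} (hp : 1 ≤ p) :
    ∃ ν : Measure ℝ, SFinite ν ∧ (∀ᵐ s ∂ν, 0 ≤ s) ∧
      ∀ z, 0 ≤ z → ∫⁻ s, ENNReal.ofReal (z - s) ∂ν = ENNReal.ofReal (z ^ p) := by
  rcases hp.eq_or_lt with rfl | hp
  · exact ⟨Measure.dirac 0, inferInstance, by simp, fun z _ => by simp⟩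
  refine ⟨(volume.restrict (Set.Ioi 0)).withDensity
    fun s => ENNReal.ofReal (p * (p - 1) * s ^ (p - 2)), inferInstance,
    (withDensity_absolutelyContinuous _ _).ae_le
      ((ae_restrict_mem measurableSet_Ioi).mono fun s hs => le_of_lt hs), fun z hz => ?_⟩
  rw [lintegral_withDensity_eq_lintegral_mul _ (by fun_prop) (by fun_prop)]
  have h1 : ∫⁻ s in Set.Ioi 0, ((fun s => ENNReal.ofReal (p * (p - 1) * s ^ (p - 2))) *
      fun s => ENNReal.ofReal (z - s)) s =
      ∫⁻ s in Set.Ioc 0 z,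
        ENNReal.ofReal (p * (p - 1) * (z * s ^ (p - 2) - s ^ (p - 1))) := by
    -- Beyond `z` the truncated factor `z - s` vanishes.
    rw [← Set.Ioc_union_Ioi_eq_Ioi hz, lintegral_union measurableSet_Ioi
      (Set.Ioc_disjoint_Ioi le_rfl), ← add_zero (∫⁻ s in Set.Ioc 0 z, ENNReal.ofReal _)]
    congr 1
    · refine setLIntegral_congr_fun measurableSet_Ioc fun s hs => ?_
      have : 0 ≤ p * (p - 1) * s ^ (p - 2) :=
        mul_nonneg (by nlinarith) (Real.rpow_nonneg hs.1.le _)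
      rw [Pi.mul_apply, ← ENNReal.ofReal_mul this]
      congr 1
      rw [show p - 1 = (p - 2) + 1 by ring, Real.rpow_add_one hs.1.ne']
      ring
    · refine (setLIntegral_congr_fun measurableSet_Ioi fun s (hs : z < s) => ?_).trans
        lintegral_zero
      simp [ENNReal.ofReal_of_nonpos (sub_nonpos.2 hs.le)]
  rw [h1]
  have hi1 : IntervalIntegrable (fun s : ℝ => s ^ (p - 2)) volume 0 z :=
    intervalIntegral.intervalIntegrable_rpow' (by linarith)
  have hi2 : IntervalIntegrable (fun s : ℝ => s ^ (p - 1)) volume 0 z :=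
    intervalIntegral.intervalIntegrable_rpow' (by linarith)
  have hi := ((hi1.const_mul z).sub hi2).const_mul (p * (p - 1))
  rw [← ofReal_integral_eq_lintegral_ofReal
    ((intervalIntegrable_iff_integrableOn_Ioc_of_le hz).1 hi), ← intervalIntegral.integral_of_le hz]
  · congr 1
    rw [intervalIntegral.integral_const_mul, intervalIntegral.integral_sub (hi1.const_mul z) hi2,
      intervalIntegral.integral_const_mul, integral_rpow (Or.inl (by linarith)),
      integral_rpow (Or.inl (by linarith))]
    rcases hz.eq_or_lt with rfl | hz
    · simp [Real.zero_rpow (show p - 2 + 1 ≠ 0 by linarith),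
        Real.zero_rpow (show p ≠ 0 by linarith)]
    · rw [Real.zero_rpow (show p - 2 + 1 ≠ 0 by linarith),
        Real.zero_rpow (show p - 1 + 1 ≠ 0 by linarith), show p - 2 + 1 = p - 1 by ring,
        show p - 1 + 1 = p by ring, show z ^ p = z * z ^ (p - 1) by
          rw [mul_comm, ← Real.rpow_add_one hz.ne']; ring_nf]
      have : p - 1 ≠ 0 := by linarith
      have : p ≠ 0 := by linarith
      field_simp
      ring
  · refine (ae_restrict_mem measurableSet_Ioc).mono fun s hs => ?_
    have h2 : s ^ (p - 1) = s * s ^ (p - 2) := by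
      rw [mul_comm, ← Real.rpow_add_one hs.1.ne']; ring_nf
    have h3 := Real.rpow_nonneg hs.1.le (p - 2)
    simp only [Pi.zero_apply, h2, ← sub_mul]
    exact mul_nonneg (by nlinarith) (mul_nonneg (by linarith [hs.2]) h3)

/-- The pairs of points that are separated, in this order, by the interval from `w.2` to
`w.2 + w.1`. -/
def separatedPairs (w : ℝ × ℝ) : Set (ℝ × ℝ) := {z | z.1 ≤ w.2 ∧ w.2 + w.1 < z.2}

theorem measurableSet_separatedPairs (w : ℝ × ℝ) : MeasurableSet (separatedPairs w) :=
  (measurableSet_le measurable_fst measurable_const).inter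
    (measurableSet_lt measurable_const measurable_snd)

theorem measurableSet_mem_separatedPairs :
    MeasurableSet {q : (ℝ × ℝ) × (ℝ × ℝ) | q.1 ∈ separatedPairs q.2} := by
  have h1 : MeasurableSet {q : (ℝ × ℝ) × (ℝ × ℝ) | q.1.1 ≤ q.2.2} :=
    measurableSet_le (by fun_prop) (by fun_prop)
  have h2 : MeasurableSet {q : (ℝ × ℝ) × (ℝ × ℝ) | q.2.2 + q.2.1 < q.1.2} :=
    measurableSet_lt (by fun_prop) (by fun_prop)
  exact h1.inter h2

/-- For fixed `s`, the levels `u` for which `(s, u)` separates `z` form `[z.1, z.2 - s)`, of length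
the positive part of `z.2 - z.1 - s`. -/
theorem lintegral_prod_separatedPairs (ν : Measure ℝ) [SFinite ν] (z : ℝ × ℝ) :
    ∫⁻ w, (separatedPairs w).indicator 1 z ∂(ν.prod volume) =
      ∫⁻ s, ENNReal.ofReal (z.2 - z.1 - s) ∂ν := by
  have hm : Measurable fun w : ℝ × ℝ => (separatedPairs w).indicator (1 : ℝ × ℝ → ℝ≥0∞) z :=
    (measurable_one.indicator measurableSet_mem_separatedPairs).comp
      (measurable_prodMk_left (x := z))
  rw [lintegral_prod _ hm.aemeasurable]
  refine lintegral_congr fun s => ?_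
  have h : (fun u => (separatedPairs (s, u)).indicator (1 : ℝ × ℝ → ℝ≥0∞) z) =
      (Set.Ico z.1 (z.2 - s)).indicator 1 := by
    ext u
    have hiff : z ∈ separatedPairs (s, u) ↔ u ∈ Set.Ico z.1 (z.2 - s) :=
      and_congr_right fun _ => lt_sub_iff_add_lt.symm
    by_cases hu : u ∈ Set.Ico z.1 (z.2 - s)
    · rw [Set.indicator_of_mem hu, Set.indicator_of_mem (hiff.2 hu)]; rfl
    · rw [Set.indicator_of_notMem hu, Set.indicator_of_notMem (mt hiff.1 hu)]
  rw [h, lintegral_indicator_one measurableSet_Ico, Real.volume_Ico]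
  congr 1; ring

/-- The mixing measure is the second derivative of the cost times Lebesgue measure. The indicators
of `z` and `z.swap` cover the two orders of the points; as `ν` lives on `s ≥ 0`, only the correct
order contributes. -/
theorem exists_edist_rpow_eq_lintegral {p : ℝ} (hp : 1 ≤ p) :
    ∃ m : Measure (ℝ × ℝ), SFinite m ∧ ∀ z : ℝ × ℝ, edist z.1 z.2 ^ p =
      ∫⁻ w, (separatedPairs w).indicator 1 z + (separatedPairs w).indicator 1 z.swap ∂m := by
  obtain ⟨ν, hν, hν0, h⟩ := exists_lintegral_ofReal_sub_eq_rpow hp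
  have hneg : ∀ z ≤ 0, ∫⁻ s, ENNReal.ofReal (z - s) ∂ν = 0 := fun z hz =>
    (lintegral_congr_ae (hν0.mono fun s hs => ENNReal.ofReal_of_nonpos (by linarith))).trans
      lintegral_zero
  have key : ∀ x y : ℝ, x ≤ y → edist x y ^ p = ENNReal.ofReal ((y - x) ^ p) := fun x y hxy => by
    rw [edist_dist, Real.dist_eq, abs_sub_comm, abs_of_nonneg (by linarith),
      ENNReal.ofReal_rpow_of_nonneg (by linarith) (by linarith)]
  refine ⟨ν.prod volume, inferInstance, fun z => ?_⟩
  have hm : Measurable fun w : ℝ × ℝ => (separatedPairs w).indicator (1 : ℝ × ℝ → ℝ≥0∞) z :=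
    (measurable_one.indicator measurableSet_mem_separatedPairs).comp
      (measurable_prodMk_left (x := z))
  rw [lintegral_add_left hm, lintegral_prod_separatedPairs,
    lintegral_prod_separatedPairs]
  rcases le_total z.1 z.2 with hz | hz
  · rw [h _ (sub_nonneg.2 hz), hneg _ (by simpa using hz), add_zero, key _ _ hz]
  · rw [hneg _ (by simpa using hz), zero_add, edist_comm, key _ _ hz, Prod.fst_swap, Prod.snd_swap,
      h _ (sub_nonneg.2 hz)]

theorem isProbabilityMeasure_of_mem_couplings {μ ν : Measure ℝ} [IsProbabilityMeasure μ]
    {ρ : Measure (ℝ × ℝ)} (hρ : ρ ∈ couplings μ ν) : IsProbabilityMeasure ρ := by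
  refine ⟨?_⟩
  rw [← Set.preimage_univ (f := Prod.fst), ← Measure.map_apply measurable_fst .univ, hρ.1,
    measure_univ]

theorem swap_mem_couplings {μ ν : Measure ℝ} {ρ : Measure (ℝ × ℝ)} (hρ : ρ ∈ couplings μ ν) :
    ρ.map Prod.swap ∈ couplings ν μ := by
  constructor
  · rw [Measure.map_map measurable_fst measurable_swap]; exact hρ.2
  · rw [Measure.map_map measurable_snd measurable_swap]; exact hρ.1

/-- The monotone coupling of two measures on `ℝ`. -/
def quantileCoupling (μ ν : Measure ℝ) : Measure (ℝ × ℝ) :=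
  unitUniform.map fun t => (quantile μ t, quantile ν t)

theorem quantileCoupling_mem_couplings (μ ν : Measure ℝ) [IsProbabilityMeasure μ]
    [IsProbabilityMeasure ν] : quantileCoupling μ ν ∈ couplings μ ν := by
  have h := (measurable_quantile μ).prodMk (measurable_quantile ν)
  constructor
  · rw [quantileCoupling, Measure.map_map measurable_fst h]; exact map_quantile μ
  · rw [quantileCoupling, Measure.map_map measurable_snd h]; exact map_quantile ν

theorem map_swap_quantileCoupling (μ ν : Measure ℝ) [IsProbabilityMeasure μ]
    [IsProbabilityMeasure ν] : (quantileCoupling μ ν).map Prod.swap = quantileCoupling ν μ := by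
  rw [quantileCoupling, Measure.map_map measurable_swap
    ((measurable_quantile μ).prodMk (measurable_quantile ν))]
  rfl

/-- With `w = (s, u)`, the positive part of `cdf μ u - cdf ν (u + s)` lies between the two sides. It
bounds the quantile coupling because the levels in question lie between the two cdf values, and any
coupling from below because `z.1 ≤ u` forces separation or `z.2 ≤ u + s`. -/
theorem quantileCoupling_separatedPairs_le {μ ν : Measure ℝ} [IsProbabilityMeasure μ]
    [IsProbabilityMeasure ν] {ρ : Measure (ℝ × ℝ)} (hρ : ρ ∈ couplings μ ν) (w : ℝ × ℝ) :
    quantileCoupling μ ν (separatedPairs w) ≤ ρ (separatedPairs w) := by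
  have := isProbabilityMeasure_of_mem_couplings hρ
  have hq := (measurable_quantile μ).prodMk (measurable_quantile ν)
  have hl : quantileCoupling μ ν (separatedPairs w) ≤
      ENNReal.ofReal (cdf μ w.2 - cdf ν (w.2 + w.1)) := by
    rw [quantileCoupling, Measure.map_apply hq (measurableSet_separatedPairs w), unitUniform,
      Measure.restrict_apply (hq (measurableSet_separatedPairs w)), ← Real.volume_Ioc]
    refine measure_mono fun t ⟨ht, ht'⟩ => ?_
    simp only [separatedPairs, Set.mem_preimage, Set.mem_ofPred_eq, quantile_le_iff μ ht',
      ← not_le, quantile_le_iff ν ht'] at ht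
    exact ⟨not_le.1 ht.2, ht.1⟩
  refine hl.trans ?_
  rw [ENNReal.ofReal_sub _ (cdf_nonneg _ _), ofReal_cdf, ofReal_cdf, tsub_le_iff_right]
  conv_lhs => rw [← hρ.1]
  conv_rhs => rw [← hρ.2]
  rw [Measure.map_apply measurable_fst measurableSet_Iic,
    Measure.map_apply measurable_snd measurableSet_Iic]
  refine (measure_mono ?_).trans (measure_union_le _ _)
  intro z (hz : z.1 ≤ w.2)
  rcases le_or_gt z.2 (w.2 + w.1) with h | h
  · exact Or.inr h
  · exact Or.inl ⟨hz, h⟩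

/-- By Tonelli the cost of a coupling is a mixture of the masses it and its swap give to separated
pairs, and each of these masses is minimal for the quantile coupling. -/
theorem lintegral_quantileCoupling_le {p : ℝ} (hp : 1 ≤ p) {μ ν : Measure ℝ}
    [IsProbabilityMeasure μ] [IsProbabilityMeasure ν] {ρ : Measure (ℝ × ℝ)}
    (hρ : ρ ∈ couplings μ ν) :
    ∫⁻ z, edist z.1 z.2 ^ p ∂(quantileCoupling μ ν) ≤ ∫⁻ z, edist z.1 z.2 ^ p ∂ρ := by
  obtain ⟨m, hm, h⟩ := exists_edist_rpow_eq_lintegral hp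
  have key : ∀ σ : Measure (ℝ × ℝ), IsProbabilityMeasure σ → ∫⁻ z, edist z.1 z.2 ^ p ∂σ =
      ∫⁻ w, σ (separatedPairs w) + σ.map Prod.swap (separatedPairs w) ∂m := by
    intro σ _
    have hi : Measurable fun q : (ℝ × ℝ) × (ℝ × ℝ) =>
        (separatedPairs q.2).indicator (1 : ℝ × ℝ → ℝ≥0∞) q.1 :=
      measurable_one.indicator measurableSet_mem_separatedPairs
    simp_rw [h]
    rw [lintegral_lintegral_swap]
    · refine lintegral_congr fun w => ?_
      have hiw : Measurable fun z : ℝ × ℝ =>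
          (separatedPairs w).indicator (1 : ℝ × ℝ → ℝ≥0∞) z :=
        measurable_one.indicator (measurableSet_separatedPairs w)
      rw [lintegral_add_left hiw, ← lintegral_map hiw measurable_swap,
        lintegral_indicator_one (measurableSet_separatedPairs w),
        lintegral_indicator_one (measurableSet_separatedPairs w)]
    · exact (hi.add (hi.comp ((measurable_swap.comp measurable_fst).prodMk
        measurable_snd))).aemeasurable
  rw [key _ (isProbabilityMeasure_of_mem_couplings (quantileCoupling_mem_couplings μ ν)),
    key _ (isProbabilityMeasure_of_mem_couplings hρ), map_swap_quantileCoupling]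
  exact lintegral_mono fun w => add_le_add (quantileCoupling_separatedPairs_le hρ w)
    (quantileCoupling_separatedPairs_le (swap_mem_couplings hρ) w)

/-! ### The Wasserstein distance on the real line -/

theorem wasserstein_rpow {p : ℝ} (hp : 1 ≤ p) (μ ν : Measure ℝ) :
    wasserstein p μ ν ^ p = ⨅ ρ ∈ couplings μ ν, ∫⁻ z, edist z.1 z.2 ^ p ∂ρ := by
  rw [wasserstein, one_div, ENNReal.rpow_inv_rpow (by linarith)]

theorem wasserstein_rpow_le {p : ℝ} (hp : 1 ≤ p) {μ ν : Measure ℝ} {ρ : Measure (ℝ × ℝ)}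
    (hρ : ρ ∈ couplings μ ν) : wasserstein p μ ν ^ p ≤ ∫⁻ z, edist z.1 z.2 ^ p ∂ρ :=
  (wasserstein_rpow hp μ ν).trans_le (iInf₂_le ρ hρ)

theorem wasserstein_rpow_eq {p : ℝ} (hp : 1 ≤ p) (μ ν : Measure ℝ) [IsProbabilityMeasure μ]
    [IsProbabilityMeasure ν] : wasserstein p μ ν ^ p =
      ∫⁻ t, edist (quantile μ t) (quantile ν t) ^ p ∂unitUniform := by
  have h : ∫⁻ z, edist z.1 z.2 ^ p ∂(quantileCoupling μ ν) =
      ∫⁻ t, edist (quantile μ t) (quantile ν t) ^ p ∂unitUniform :=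
    lintegral_map (by fun_prop) ((measurable_quantile μ).prodMk (measurable_quantile ν))
  rw [← h]
  refine (wasserstein_rpow_le hp (quantileCoupling_mem_couplings μ ν)).antisymm ?_
  rw [wasserstein_rpow hp]
  exact le_iInf₂ fun ρ hρ => lintegral_quantileCoupling_le hp hρ

theorem eq_of_wasserstein_eq_zero {p : ℝ} (hp : 1 ≤ p) {μ ν : Measure ℝ} [IsProbabilityMeasure μ]
    [IsProbabilityMeasure ν] (h : wasserstein p μ ν = 0) : μ = ν := by
  have hp0 : 0 < p := by linarith
  have h0 := wasserstein_rpow_eq hp μ ν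
  have hm : Measurable fun t => edist (quantile μ t) (quantile ν t) ^ p :=
    ((measurable_quantile μ).edist (measurable_quantile ν)).pow_const p
  rw [h, ENNReal.zero_rpow_of_pos hp0, eq_comm, lintegral_eq_zero_iff hm] at h0
  rw [← map_quantile μ, ← map_quantile ν]
  refine Measure.map_congr (h0.mono fun t ht => ?_)
  simpa [ENNReal.rpow_eq_zero_iff, hp0, hp0.not_gt] using ht

/-- The independent coupling suffices for this crude bound, which serves only to make the supremal
distance finite. -/
theorem wasserstein_rpow_le_moments {p : ℝ} (hp : 1 ≤ p) (μ ν : Measure ℝ)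
    [IsProbabilityMeasure μ] [IsProbabilityMeasure ν] : wasserstein p μ ν ^ p ≤
      2 ^ (p - 1) * (∫⁻ z, ‖z‖ₑ ^ p ∂μ + ∫⁻ z, ‖z‖ₑ ^ p ∂ν) := by
  have hμν : μ.prod ν ∈ couplings μ ν := by constructor <;> simp
  refine (wasserstein_rpow_le hp hμν).trans ?_
  have hm : Measurable fun z : ℝ × ℝ => ‖z.1‖ₑ ^ p := by fun_prop
  calc ∫⁻ z, edist z.1 z.2 ^ p ∂(μ.prod ν)
      ≤ ∫⁻ z, 2 ^ (p - 1) * (‖z.1‖ₑ ^ p + ‖z.2‖ₑ ^ p) ∂(μ.prod ν) := by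
        refine lintegral_mono fun z => le_trans ?_ (ENNReal.rpow_add_le_mul_rpow_add_rpow _ _ hp)
        refine ENNReal.rpow_le_rpow ?_ (by linarith)
        rw [edist_eq_enorm_sub]
        exact enorm_sub_le
    _ = _ := by
        rw [lintegral_const_mul _ (by fun_prop), lintegral_add_left hm,
          lintegral_prod _ (by fun_prop), lintegral_prod _ (by fun_prop)]
        simp

/-! ### Homogeneous Markov chains -/

section Homogeneous

variable {E : Type*} [MeasurableSpace E]

/-- A kernel on `E`, as the kernel that prolongs a path up to time `n`. -/
abbrev pathKernel (K : Kernel E E) (n : ℕ) : Kernel ((i : Finset.Iic n) → E) E :=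
  K.comap (fun h => h ⟨n, Finset.mem_Iic.2 le_rfl⟩) (measurable_pi_apply _)

/-- The first `n + 1` terms of a sequence. -/
abbrev pathUpTo (n : ℕ) (ω : ℕ → E) : (i : Finset.Iic n) → E :=
  Preorder.frestrictLe (π := fun _ => E) n ω

/-- The law of the Markov chain with kernel `K`, given its path up to time `n`. -/
abbrev chainLaw (K : Kernel E E) [IsMarkovKernel K] (n : ℕ) :
    Kernel ((i : Finset.Iic n) → E) (ℕ → E) :=
  Kernel.traj (X := fun _ => E) (pathKernel K) n

/-- The path `h` prolonged by the point `e`. -/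
def snocPath (n : ℕ) (w : ((i : Finset.Iic n) → E) × E) : (i : Finset.Iic (n + 1)) → E :=
  fun i => if hi : (i : ℕ) ≤ n then w.1 ⟨i, Finset.mem_Iic.2 hi⟩ else w.2

theorem measurable_snocPath (n : ℕ) : Measurable (snocPath (E := E) n) := by
  refine measurable_pi_lambda _ fun i => ?_
  by_cases hi : (i : ℕ) ≤ n
  · simp only [snocPath, hi, dite_true]; fun_prop
  · simp only [snocPath, hi, dite_false]; fun_prop

theorem snocPath_pathUpTo {E : Type*} (n : ℕ) (ω : ℕ → E) :
    snocPath n (pathUpTo n ω, ω (n + 1)) = pathUpTo (n + 1) ω := by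
  funext i
  by_cases hi : (i : ℕ) ≤ n
  · simp [snocPath, hi]
  · have : (i : ℕ) = n + 1 := le_antisymm (Finset.mem_Iic.1 i.2) (by omega)
    simp [snocPath, this]

theorem chainLaw_map_step (K : Kernel E E) [IsMarkovKernel K] {a n : ℕ} (h : a ≤ n)
    (u : (i : Finset.Iic a) → E) :
    (chainLaw K a u).map (fun ω => (pathUpTo n ω, ω (n + 1))) =
      ((chainLaw K a u).map (pathUpTo n)) ⊗ₘ pathKernel K n := by
  refine (Kernel.partialTraj_compProd_eq_map_traj (X := fun _ => E) (κ := pathKernel K) h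
    (x₀ := u)).symm.trans ?_
  congr 1
  exact (Kernel.traj_map_frestrictLe_apply (X := fun _ => E) a n u).symm

/-- The initial law and the one-step transitions determine the laws of all finite initial paths by
induction, and a projective limit is unique. -/
theorem eq_chainLaw (K : Kernel E E) [IsMarkovKernel K] (u : (i : Finset.Iic 0) → E)
    (m : Measure (ℕ → E)) (h0 : m.map (pathUpTo 0) = Measure.dirac u)
    (hm : ∀ n, m.map (fun ω => (pathUpTo n ω, ω (n + 1))) =
      (m.map (pathUpTo n)) ⊗ₘ pathKernel K n) : m = chainLaw K 0 u := by
  have key : ∀ n, m.map (pathUpTo n) = (chainLaw K 0 u).map (pathUpTo n) := by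
    intro n
    induction n with
    | zero =>
      rw [h0, Kernel.traj_map_frestrictLe_apply, Kernel.partialTraj_self, Kernel.id_apply]
    | succ n ih =>
      have hs : pathUpTo (E := E) (n + 1) = snocPath n ∘ fun ω => (pathUpTo n ω, ω (n + 1)) :=
        funext fun ω => (snocPath_pathUpTo n ω).symm
      rw [hs, ← Measure.map_map (measurable_snocPath n) (by fun_prop),
        ← Measure.map_map (measurable_snocPath n) (by fun_prop), hm, ih,
        chainLaw_map_step K (Nat.zero_le n)]
  have hlim := Kernel.isProjectiveLimit_trajFun (X := fun _ => E) (pathKernel K) 0 u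
  have (I : Finset ℕ) : IsFiniteMeasure (inducedFamily (X := fun _ => E)
      (fun n => Kernel.partialTraj (X := fun _ => E) (pathKernel K) 0 n u) I) := by
    unfold inducedFamily; infer_instance
  refine IsProjectiveLimit.unique ?_ hlim
  refine (isProjectiveLimit_nat_iff
    (Kernel.isProjectiveMeasureFamily_partialTraj (X := fun _ => E) (κ := pathKernel K) u) m).2 fun n => ?_
  rw [inducedFamily_Iic, ← Kernel.traj_map_frestrictLe_apply]
  exact key n

/-- The shift of sequences. -/
def shiftSeq (ω : ℕ → E) : ℕ → E := fun n => ω (n + 1)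

theorem measurable_shiftSeq : Measurable (shiftSeq (E := E)) := by
  unfold shiftSeq; fun_prop

/-- The path `h` without its initial point. -/
def tailPath (n : ℕ) (h : (i : Finset.Iic (n + 1)) → E) : (i : Finset.Iic n) → E :=
  fun i => h ⟨i + 1, Finset.mem_Iic.2 (Nat.succ_le_succ (Finset.mem_Iic.1 i.2))⟩

theorem measurable_tailPath (n : ℕ) : Measurable (tailPath (E := E) n) := by
  unfold tailPath; fun_prop

theorem map_compProd_comap {F G H : Type*} [MeasurableSpace F] [MeasurableSpace G]
    [MeasurableSpace H] (μ : Measure F) [SFinite μ] (κ : Kernel G H) [IsSFiniteKernel κ]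
    {f : F → G} (hf : Measurable f) :
    (μ ⊗ₘ κ.comap f hf).map (Prod.map f id) = (μ.map f) ⊗ₘ κ := by
  ext s hs
  rw [Measure.map_apply (hf.prodMap measurable_id) hs, Measure.compProd_apply
    (hf.prodMap measurable_id hs), Measure.compProd_apply hs,
    lintegral_map (Kernel.measurable_kernel_prodMk_left hs) hf]
  rfl

/-- Time-homogeneity: the shifted law satisfies the characterization `eq_chainLaw` of the chain
started at the point occupied at time 1. -/
theorem chainLaw_one_map_shift (K : Kernel E E) [IsMarkovKernel K]
    (u : (i : Finset.Iic 1) → E) :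
    (chainLaw K 1 u).map shiftSeq =
      chainLaw K 0 (fun _ => u ⟨1, Finset.mem_Iic.2 le_rfl⟩) := by
  have hpath : ∀ n, pathUpTo (E := E) n ∘ shiftSeq = tailPath n ∘ pathUpTo (n + 1) :=
    fun n => rfl
  refine eq_chainLaw K _ _ ?_ fun n => ?_
  · rw [Measure.map_map (by fun_prop) measurable_shiftSeq, hpath,
      ← Measure.map_map (measurable_tailPath 0) (by fun_prop),
      Kernel.traj_map_frestrictLe_apply, Kernel.partialTraj_self, Kernel.id_apply,
      Measure.map_dirac' (measurable_tailPath 0)]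
    congr 1
    funext ⟨i, hi⟩
    obtain rfl : i = 0 := by simpa using hi
    rfl
  · have h1 : (fun ω : ℕ → E => (pathUpTo n ω, ω (n + 1))) ∘ shiftSeq =
        Prod.map (tailPath n) id ∘ fun ω => (pathUpTo (n + 1) ω, ω (n + 1 + 1)) := rfl
    rw [Measure.map_map (by fun_prop) measurable_shiftSeq, h1,
      ← Measure.map_map ((measurable_tailPath n).prodMap measurable_id) (by fun_prop),
      chainLaw_map_step K (Nat.le_add_left 1 n),
      Measure.map_map (by fun_prop) measurable_shiftSeq, hpath,
      ← Measure.map_map (measurable_tailPath n) (by fun_prop)]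
    -- The kernel reads only the last point of a path, which `tailPath` keeps, so `pathKernel K (n +
    -- 1)` is `pathKernel K n` composed with `tailPath n`.
    exact map_compProd_comap _ (pathKernel K n) (measurable_tailPath n)

end Homogeneous

/-! ### The state-action chain and its Markov property at time 1 -/

namespace DecisionProcess

variable {X A : Type*} [MeasurableSpace X] [MeasurableSpace A]

instance (M : DecisionProcess X A) (π : Kernel X A) [IsMarkovKernel π] :
    IsMarkovKernel (M.trajectory π) := by
  unfold trajectory; infer_instance

theorem trajectory_apply (M : DecisionProcess X A) (π : Kernel X A) [IsMarkovKernel π]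
    (xa : X × A) : M.trajectory π xa = chainLaw (M.stateActionKernel π) 0 (fun _ => xa) := rfl

/-- The chain starts at `xa` almost surely; this form exchanges `ω 0` and `xa` under an integral. -/
theorem lintegral_trajectory_zero (M : DecisionProcess X A) (π : Kernel X A) [IsMarkovKernel π]
    (xa : X × A) {F : X × A → (ℕ → X × A) → ℝ≥0∞} (hF : Measurable (Function.uncurry F)) :
    ∫⁻ ω, F (ω 0) ω ∂(M.trajectory π xa) = ∫⁻ ω, F xa ω ∂(M.trajectory π xa) := by
  have h1 : Measurable fun ω : ℕ → X × A => F (ω 0) ω :=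
    hF.comp (f := fun ω : ℕ → X × A => (ω 0, ω)) (by fun_prop)
  have h2 : Measurable fun ω : ℕ → X × A => F xa ω := hF.comp measurable_prodMk_left
  rw [trajectory_apply, Kernel.lintegral_traj _ h1, Kernel.lintegral_traj _ h2]
  rfl

/-- The trajectory is built by drawing the path up to time 1 and then continuing; its time-1 point
has law `stateActionKernel`, and the shifted continuation depends on the path only through that
point. -/
theorem trajectory_map_shift (M : DecisionProcess X A) (π : Kernel X A) [IsMarkovKernel π]
    (xa : X × A) :
    (M.trajectory π xa).map shiftSeq = (M.stateActionKernel π xa).bind (M.trajectory π) := by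
  have h1 : M.trajectory π xa =
      (Kernel.partialTraj (X := fun _ => X × A) (pathKernel (M.stateActionKernel π)) 0 1
        (fun _ => xa)).bind (chainLaw (M.stateActionKernel π) 1) := by
    rw [← Kernel.comp_apply, Kernel.traj_comp_partialTraj zero_le_one]
    rfl
  have h2 : (Kernel.partialTraj (X := fun _ => X × A) (pathKernel (M.stateActionKernel π)) 0 1
      (fun _ => xa)).map (fun h => h ⟨1, Finset.mem_Iic.2 le_rfl⟩) =
      M.stateActionKernel π xa := by
    rw [← Kernel.map_apply _ (by fun_prop)]
    exact DFunLike.congr_fun (Kernel.map_partialTraj_succ_self (X := fun _ => X × A)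
      (κ := pathKernel (M.stateActionKernel π)) 0) (fun _ => xa)
  refine Measure.ext_of_lintegral _ fun f hf => ?_
  have hfs : Measurable fun ω => f (shiftSeq ω) := hf.comp measurable_shiftSeq
  rw [lintegral_map hf measurable_shiftSeq, h1,
    Measure.lintegral_bind (Kernel.measurable _).aemeasurable hfs.aemeasurable,
    Measure.lintegral_bind (Kernel.measurable _).aemeasurable hf.aemeasurable, ← h2,
    lintegral_map (hf.lintegral_kernel) (by fun_prop)]
  refine lintegral_congr fun u => ?_
  rw [trajectory_apply, ← chainLaw_one_map_shift, lintegral_map hf measurable_shiftSeq]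

theorem lintegral_trajectory_shift (M : DecisionProcess X A) (π : Kernel X A) [IsMarkovKernel π]
    (xa : X × A) {f : (ℕ → X × A) → ℝ≥0∞} (hf : Measurable f) :
    ∫⁻ ω, f (shiftSeq ω) ∂(M.trajectory π xa) =
      ∫⁻ y, ∫⁻ ω, f ω ∂(M.trajectory π y) ∂(M.stateActionKernel π xa) := by
  rw [← lintegral_map hf measurable_shiftSeq, trajectory_map_shift,
    Measure.lintegral_bind (Kernel.measurable _).aemeasurable hf.aemeasurable]

theorem lintegral_stateActionKernel_fst (M : DecisionProcess X A) (π : Kernel X A)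
    [IsMarkovKernel π] (xa : X × A) {f : X → ℝ≥0∞} (hf : Measurable f) :
    ∫⁻ y, f y.1 ∂(M.stateActionKernel π xa) = ∫⁻ x, f x ∂(M.P xa) := by
  rw [stateActionKernel, Kernel.lintegral_compProd _ _ _ (by fun_prop)]
  simp

/-- As `toReal` sends `∞` to `0`, the bound holds at every `x`, and the moment estimates need no
separate treatment of infinite penalties. -/
theorem enorm_penalty_le (π πref : Kernel X A) {τ : ℝ} (hτ : 0 ≤ τ) (x : X) :
    ‖τ * (klPenalty π πref x).toReal‖ₑ ≤ ENNReal.ofReal τ * klPenalty π πref x := by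
  rw [enorm_mul, Real.enorm_of_nonneg hτ, Real.enorm_of_nonneg ENNReal.toReal_nonneg]
  gcongr
  exact ENNReal.ofReal_toReal_le

theorem enorm_reward_le {M : DecisionProcess X A} {C : ℝ} (hC : ∀ xa, |M.r xa| ≤ C)
    (xa : X × A) : ‖M.r xa‖ₑ ≤ ENNReal.ofReal C := by
  rw [Real.enorm_eq_ofReal_abs]
  exact ENNReal.ofReal_le_ofReal (hC xa)

variable [MeasurableSpace.CountablyGenerated A]

/-! ### The soft Bellman operator -/

theorem lintegral_softBellman (M : DecisionProcess X A) (π πref : Kernel X A) [IsMarkovKernel π]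
    [IsMarkovKernel πref] (τ : ℝ) (ζ : Kernel (X × A) ℝ) [IsMarkovKernel ζ] (xa : X × A)
    {f : ℝ → ℝ≥0∞} (hf : Measurable f) :
    ∫⁻ z, f z ∂(M.softBellman π πref τ ζ xa) =
      ∫⁻ y, ∫⁻ z, f (M.r xa + M.γ * z - M.γ * τ * (klPenalty π πref y.1).toReal) ∂(ζ y)
        ∂(M.stateActionKernel π xa) := by
  have hkl := measurable_klPenalty π πref
  have hg : Measurable fun y : (X × A) × ℝ =>
      M.r xa + M.γ * y.2 - M.γ * τ * (klPenalty π πref y.1.1).toReal := by fun_prop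
  have h : M.softBellman π πref τ ζ xa =
      ((M.stateActionKernel π ⊗ₖ Kernel.prodMkLeft (X × A) ζ) xa).map
        (fun y : (X × A) × ℝ =>
          M.r xa + M.γ * y.2 - M.γ * τ * (klPenalty π πref y.1.1).toReal) := rfl
  rw [h, lintegral_map hf hg, Kernel.lintegral_compProd _ _ _ (by fun_prop)]
  rfl

theorem isMarkovKernel_softBellman (M : DecisionProcess X A) (π πref : Kernel X A)
    [IsMarkovKernel π] [IsMarkovKernel πref] (τ : ℝ) (ζ : Kernel (X × A) ℝ) [IsMarkovKernel ζ] :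
    IsMarkovKernel (M.softBellman π πref τ ζ) := by
  refine ⟨fun xa => ⟨?_⟩⟩
  rw [← lintegral_one, lintegral_softBellman M π πref τ ζ xa measurable_const]
  simp

theorem exists_penalty_moment_bound (M : DecisionProcess X A) (π πref : Kernel X A)
    [IsMarkovKernel π] [IsMarkovKernel πref] {p : ℝ} (hp : 1 ≤ p) {τ : ℝ}
    (hkl : ⨆ xa, eLpNorm (fun x' => ENNReal.ofReal τ * klPenalty π πref x')
      (ENNReal.ofReal p) (M.P xa) < ∞) :
    ∃ B < ∞, ∀ xa, ∫⁻ y, (ENNReal.ofReal τ * klPenalty π πref y.1) ^ p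
      ∂(M.stateActionKernel π xa) ≤ B := by
  have hp0 : 0 < p := by linarith
  have hm := measurable_klPenalty π πref
  refine ⟨_, ENNReal.rpow_lt_top_of_nonneg hp0.le hkl.ne, fun xa => ?_⟩
  rw [lintegral_stateActionKernel_fst M π xa
    (f := fun x => (ENNReal.ofReal τ * klPenalty π πref x) ^ p) (by fun_prop)]
  refine le_trans ?_ (ENNReal.rpow_le_rpow (le_iSup _ xa) hp0.le)
  rw [eLpNorm_eq_lintegral_rpow_enorm_toReal (by simpa using hp0) ENNReal.ofReal_ne_top,
    ENNReal.toReal_ofReal hp0.le, one_div, ENNReal.rpow_inv_rpow hp0.ne']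
  simp

/-- The inequality `(a + b) ^ p ≤ 2 ^ (p - 1) * (a ^ p + b ^ p)`, applied twice, separates reward,
target and penalty, each with a `p`-th moment bounded uniformly in the starting pair. -/
theorem softBellman_mem_momentKernels (M : DecisionProcess X A)
    (hr : ∃ C : ℝ, ∀ xa, |M.r xa| ≤ C) (hγ0 : 0 ≤ M.γ) (hγ1 : M.γ < 1)
    (π πref : Kernel X A) [IsMarkovKernel π] [IsMarkovKernel πref]
    {p : ℝ} (hp : 1 ≤ p) {τ : ℝ} (hτ : 0 ≤ τ)
    (hkl : ⨆ xa, eLpNorm (fun x' => ENNReal.ofReal τ * klPenalty π πref x')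
      (ENNReal.ofReal p) (M.P xa) < ∞)
    {ζ : Kernel (X × A) ℝ} (hζ : ζ ∈ momentKernels (X × A) p) :
    M.softBellman π πref τ ζ ∈ momentKernels (X × A) p := by
  obtain ⟨C, hC⟩ := hr
  obtain ⟨B, hB, hB'⟩ := exists_penalty_moment_bound M π πref hp hkl
  obtain ⟨hζm, hζb⟩ := hζ
  have hp0 : 0 ≤ p := by linarith
  have hm := measurable_klPenalty π πref
  have h2 : (2 : ℝ≥0∞) ^ (p - 1) < ∞ :=
    ENNReal.rpow_lt_top_of_nonneg (by linarith) (by simp)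
  have hpt : ∀ (xa y : X × A) (z : ℝ),
      ‖M.r xa + M.γ * z - M.γ * τ * (klPenalty π πref y.1).toReal‖ₑ ^ p ≤
        2 ^ (p - 1) * (ENNReal.ofReal C ^ p + 2 ^ (p - 1) *
          (‖z‖ₑ ^ p + (ENNReal.ofReal τ * klPenalty π πref y.1) ^ p)) := by
    intro xa y z
    have hγe : ‖M.γ‖ₑ ≤ 1 := by
      rw [Real.enorm_of_nonneg hγ0]; exact ENNReal.ofReal_le_one.2 hγ1.le
    have h : ‖M.r xa + M.γ * z - M.γ * τ * (klPenalty π πref y.1).toReal‖ₑ ≤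
        ENNReal.ofReal C + (‖z‖ₑ + ENNReal.ofReal τ * klPenalty π πref y.1) := by
      rw [show M.r xa + M.γ * z - M.γ * τ * (klPenalty π πref y.1).toReal =
        M.r xa + M.γ * (z - τ * (klPenalty π πref y.1).toReal) by ring]
      refine (enorm_add_le _ _).trans (add_le_add (enorm_reward_le hC xa) ?_)
      rw [enorm_mul]
      refine (mul_le_of_le_one_left zero_le hγe).trans ?_
      exact enorm_sub_le.trans (add_le_add le_rfl (enorm_penalty_le π πref hτ y.1))
    refine (ENNReal.rpow_le_rpow h hp0).trans
      ((ENNReal.rpow_add_le_mul_rpow_add_rpow _ _ hp).trans ?_)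
    gcongr
    exact ENNReal.rpow_add_le_mul_rpow_add_rpow _ _ hp
  refine ⟨isMarkovKernel_softBellman M π πref τ ζ, lt_of_le_of_lt (b := 2 ^ (p - 1) *
    (ENNReal.ofReal C ^ p + 2 ^ (p - 1) * ((⨆ y, ∫⁻ z, ‖z‖ₑ ^ p ∂(ζ y)) + B)))
    (iSup_le fun xa => ?_) ?_⟩
  · rw [lintegral_softBellman M π πref τ ζ xa (by fun_prop)]
    calc _ ≤ ∫⁻ y, ∫⁻ z, 2 ^ (p - 1) * (ENNReal.ofReal C ^ p + 2 ^ (p - 1) *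
          (‖z‖ₑ ^ p + (ENNReal.ofReal τ * klPenalty π πref y.1) ^ p)) ∂(ζ y)
            ∂(M.stateActionKernel π xa) :=
          lintegral_mono fun y => lintegral_mono fun z => hpt xa y z
      _ ≤ ∫⁻ y, 2 ^ (p - 1) * (ENNReal.ofReal C ^ p + 2 ^ (p - 1) *
          ((⨆ y, ∫⁻ z, ‖z‖ₑ ^ p ∂(ζ y)) + (ENNReal.ofReal τ * klPenalty π πref y.1) ^ p))
            ∂(M.stateActionKernel π xa) := by
          refine lintegral_mono fun y => ?_
          rw [lintegral_const_mul _ (by fun_prop), lintegral_add_left (by fun_prop),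
            lintegral_const_mul _ (by fun_prop), lintegral_add_left (by fun_prop)]
          simp only [lintegral_const, measure_univ, mul_one]
          gcongr
          exact le_iSup (fun y => ∫⁻ z, ‖z‖ₑ ^ p ∂(ζ y)) y
      _ ≤ _ := by
          rw [lintegral_const_mul _ (by fun_prop), lintegral_add_left (by fun_prop),
            lintegral_const_mul _ (by fun_prop), lintegral_add_left (by fun_prop)]
          simp only [lintegral_const, measure_univ, mul_one]
          gcongr
          exact hB' xa
  · exact ENNReal.mul_lt_top h2 (ENNReal.add_lt_top.2
      ⟨ENNReal.rpow_lt_top_of_nonneg hp0 ENNReal.ofReal_ne_top,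
        ENNReal.mul_lt_top h2 (ENNReal.add_lt_top.2 ⟨hζb, hB⟩)⟩)

theorem supWasserstein_softBellman_le (M : DecisionProcess X A) (hγ0 : 0 ≤ M.γ)
    (π πref : Kernel X A) [IsMarkovKernel π] [IsMarkovKernel πref] {p : ℝ} (hp : 1 ≤ p) (τ : ℝ)
    (ζ ζ' : Kernel (X × A) ℝ) [IsMarkovKernel ζ] [IsMarkovKernel ζ'] :
    supWasserstein p (M.softBellman π πref τ ζ) (M.softBellman π πref τ ζ') ≤
      ENNReal.ofReal M.γ * supWasserstein p ζ ζ' := by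
  have hp0 : 0 < p := by linarith
  have hkl := measurable_klPenalty π πref
  refine iSup_le fun xa => ?_
  let g : X × A → ℝ → ℝ := fun y z =>
    M.r xa + M.γ * z - M.γ * τ * (klPenalty π πref y.1).toReal
  -- Substituting the quantile of `η y` at an independent uniform level for a draw from `η y`
  -- realizes the Bellman image on a space that does not depend on `η`.
  have hg : Measurable (Function.uncurry g) := by
    simp only [g, Function.uncurry_def]; fun_prop
  have hmk : ∀ η : Kernel (X × A) ℝ, IsMarkovKernel η →
      Measurable (fun w : (X × A) × ℝ => g w.1 (quantile (η w.1) w.2)) ∧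
      ((M.stateActionKernel π xa).prod unitUniform).map
        (fun w => g w.1 (quantile (η w.1) w.2)) = M.softBellman π πref τ η xa := by
    intro η _
    have hq : Measurable (fun w : (X × A) × ℝ => g w.1 (quantile (η w.1) w.2)) :=
      hg.comp (measurable_fst.prodMk (measurable_quantile_kernel η))
    refine ⟨hq, Measure.ext_of_lintegral _ fun f hf => ?_⟩
    have hfq : Measurable fun w : (X × A) × ℝ => f (g w.1 (quantile (η w.1) w.2)) :=
      hf.comp hq
    rw [lintegral_map hf hq, lintegral_prod _ hfq.aemeasurable,
      lintegral_softBellman M π πref τ η xa hf]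
    refine lintegral_congr fun y => ?_
    have hgy : Measurable fun z => f (g y z) := hf.comp (hg.comp measurable_prodMk_left)
    conv_rhs => rw [← map_quantile (η y)]
    rw [lintegral_map hgy (measurable_quantile (η y))]
  obtain ⟨h1, h1'⟩ := hmk ζ inferInstance
  obtain ⟨h2, h2'⟩ := hmk ζ' inferInstance
  have hρ : ((M.stateActionKernel π xa).prod unitUniform).map
      (fun w => (g w.1 (quantile (ζ w.1) w.2), g w.1 (quantile (ζ' w.1) w.2))) ∈
      couplings (M.softBellman π πref τ ζ xa) (M.softBellman π πref τ ζ' xa) := by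
    constructor
    · rw [Measure.map_map measurable_fst (h1.prodMk h2), ← h1']; rfl
    · rw [Measure.map_map measurable_snd (h1.prodMk h2), ← h2']; rfl
  -- Both targets see the same next pair, so reward and penalty cancel.
  have hedist : ∀ y a b, edist (g y a) (g y b) = ENNReal.ofReal M.γ * edist a b := by
    intro y a b
    rw [edist_eq_enorm_sub, edist_eq_enorm_sub, ← Real.enorm_of_nonneg hγ0, ← enorm_mul]
    congr 1
    simp only [g]; ring
  have hd : Measurable fun w : (X × A) × ℝ =>
      edist (quantile (ζ w.1) w.2) (quantile (ζ' w.1) w.2) ^ p :=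
    ((measurable_quantile_kernel ζ).edist (measurable_quantile_kernel ζ')).pow_const p
  rw [← ENNReal.rpow_le_rpow_iff hp0]
  refine (wasserstein_rpow_le hp hρ).trans ?_
  rw [lintegral_map (by fun_prop) (h1.prodMk h2)]
  simp only [hedist, ENNReal.mul_rpow_of_nonneg _ _ hp0.le]
  rw [lintegral_const_mul _ hd, lintegral_prod _ hd.aemeasurable]
  gcongr
  calc _ = ∫⁻ y, wasserstein p (ζ y) (ζ' y) ^ p ∂(M.stateActionKernel π xa) :=
        lintegral_congr fun y => (wasserstein_rpow_eq hp (ζ y) (ζ' y)).symm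
    _ ≤ ∫⁻ _, supWasserstein p ζ ζ' ^ p ∂(M.stateActionKernel π xa) :=
        lintegral_mono fun y => ENNReal.rpow_le_rpow
          (le_iSup (fun y => wasserstein p (ζ y) (ζ' y)) y) hp0.le
    _ = _ := by simp

/-- Finiteness is essential for uniqueness: an infinite distance could satisfy `d ≤ γ d`. -/
theorem supWasserstein_lt_top {Y : Type*} [MeasurableSpace Y] {p : ℝ} (hp : 1 ≤ p)
    {ζ ζ' : Kernel Y ℝ} (hζ : ζ ∈ momentKernels Y p) (hζ' : ζ' ∈ momentKernels Y p) :
    supWasserstein p ζ ζ' < ∞ := by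
  have hp0 : 0 < p := by linarith
  obtain ⟨hm, hb⟩ := hζ
  obtain ⟨hm', hb'⟩ := hζ'
  have h : ∀ y, wasserstein p (ζ y) (ζ' y) ≤ (2 ^ (p - 1) *
      ((⨆ y, ∫⁻ z, ‖z‖ₑ ^ p ∂(ζ y)) + ⨆ y, ∫⁻ z, ‖z‖ₑ ^ p ∂(ζ' y))) ^ p⁻¹ := by
    intro y
    rw [ENNReal.le_rpow_inv_iff hp0]
    refine (wasserstein_rpow_le_moments hp _ _).trans ?_
    gcongr
    · exact le_iSup (fun y => ∫⁻ z, ‖z‖ₑ ^ p ∂(ζ y)) y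
    · exact le_iSup (fun y => ∫⁻ z, ‖z‖ₑ ^ p ∂(ζ' y)) y
  refine (iSup_le h).trans_lt (ENNReal.rpow_lt_top_of_nonneg (by positivity) ?_)
  exact (ENNReal.mul_lt_top (ENNReal.rpow_lt_top_of_nonneg (by linarith) (by simp))
    (ENNReal.add_lt_top.2 ⟨hb, hb'⟩)).ne

theorem eq_of_softBellman_eq (M : DecisionProcess X A) (hγ0 : 0 ≤ M.γ) (hγ1 : M.γ < 1)
    (π πref : Kernel X A) [IsMarkovKernel π] [IsMarkovKernel πref] {p : ℝ} (hp : 1 ≤ p) (τ : ℝ)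
    {ζ ζ' : Kernel (X × A) ℝ} (hζ : ζ ∈ momentKernels (X × A) p)
    (hζ' : ζ' ∈ momentKernels (X × A) p) (h : M.softBellman π πref τ ζ = ζ)
    (h' : M.softBellman π πref τ ζ' = ζ') : ζ = ζ' := by
  have hfin := supWasserstein_lt_top hp hζ hζ'
  have := hζ.1
  have := hζ'.1
  have hle := supWasserstein_softBellman_le M hγ0 π πref hp τ ζ ζ'
  rw [h, h'] at hle
  have h0 : supWasserstein p ζ ζ' = 0 := by
    by_contra hne
    refine absurd hle (not_le.2 ?_)
    calc _ < 1 * supWasserstein p ζ ζ' :=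
          ENNReal.mul_lt_mul_left hne hfin.ne (ENNReal.ofReal_lt_one.2 hγ1)
      _ = _ := one_mul _
  ext1 y
  refine eq_of_wasserstein_eq_zero hp (le_antisymm ?_ zero_le)
  exact (le_iSup (fun y => wasserstein p (ζ y) (ζ' y)) y).trans_eq h0

end DecisionProcess

namespace DecisionProcess

variable {X A : Type*} [MeasurableSpace X] [MeasurableSpace A]

/-! ### The soft return -/

/-- A one-step bound uniform in the start passes to every later time by conditioning on the first
step. Time 0 is excluded, since `f` need not be bounded at the starting pair itself. -/
theorem lintegral_trajectory_succ_le (M : DecisionProcess X A) (π : Kernel X A)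
    [IsMarkovKernel π] {f : X × A → ℝ≥0∞} (hf : Measurable f) {D : ℝ≥0∞}
    (hD : ∀ xa, ∫⁻ y, f y ∂(M.stateActionKernel π xa) ≤ D) (t : ℕ) (xa : X × A) :
    ∫⁻ ω, f (ω (t + 1)) ∂(M.trajectory π xa) ≤ D := by
  induction t generalizing xa with
  | zero =>
    have h := lintegral_trajectory_shift M π xa (f := fun ω => f (ω 0)) (by fun_prop)
    refine h.trans_le (le_trans (le_of_eq (lintegral_congr fun y => ?_)) (hD xa))
    rw [lintegral_trajectory_zero M π y (F := fun y _ => f y) (by fun_prop)]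
    simp
  | succ t ih =>
    have h := lintegral_trajectory_shift M π xa (f := fun ω => f (ω (t + 1))) (by fun_prop)
    refine h.trans_le ((lintegral_mono fun y => ih y).trans ?_)
    simp

theorem softReturnTerm_succ (M : DecisionProcess X A) (π πref : Kernel X A) (τ : ℝ)
    (ω : ℕ → X × A) (t : ℕ) : M.softReturnTerm π πref τ ω (t + 1) =
      M.γ * M.softReturnTerm π πref τ (shiftSeq ω) t := by
  simp only [softReturnTerm, shiftSeq]; ring

/-- The shifted return omits the penalty at its own time 0, which is time 1 of `ω`; the last term
restores it. Summability is needed to split off the first term of the `tsum`. -/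
theorem softReturn_eq_shift (M : DecisionProcess X A) (π πref : Kernel X A) (τ : ℝ)
    (ω : ℕ → X × A) (h : Summable (M.softReturnTerm π πref τ ω)) :
    M.softReturn π πref τ ω = M.r (ω 0) + M.γ * M.softReturn π πref τ (shiftSeq ω) -
      M.γ * τ * (klPenalty π πref (shiftSeq ω 0).1).toReal := by
  rw [softReturn, h.tsum_eq_zero_add, softReturn]
  simp only [softReturnTerm_succ, tsum_mul_left]
  simp only [softReturnTerm, shiftSeq]
  ring

variable [MeasurableSpace.CountablyGenerated A]

theorem measurable_softReturnTerm (M : DecisionProcess X A) (π πref : Kernel X A)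
    [IsMarkovKernel π] [IsMarkovKernel πref] (τ : ℝ) (t : ℕ) :
    Measurable fun ω => M.softReturnTerm π πref τ ω t := by
  have hkl := measurable_klPenalty π πref
  have hr := M.measurable_r
  unfold softReturnTerm
  fun_prop

theorem exists_eLpNorm_softReturnTerm_le (M : DecisionProcess X A)
    (hr : ∃ C : ℝ, ∀ xa, |M.r xa| ≤ C) (hγ0 : 0 ≤ M.γ)
    (π πref : Kernel X A) [IsMarkovKernel π] [IsMarkovKernel πref]
    {p : ℝ} (hp : 1 ≤ p) {τ : ℝ} (hτ : 0 ≤ τ)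
    (hkl : ⨆ xa, eLpNorm (fun x' => ENNReal.ofReal τ * klPenalty π πref x')
      (ENNReal.ofReal p) (M.P xa) < ∞) :
    ∃ D < ∞, ∀ xa t, eLpNorm (fun ω => M.softReturnTerm π πref τ ω t) (ENNReal.ofReal p)
      (M.trajectory π xa) ≤ ENNReal.ofReal M.γ ^ (t + 1) * D := by
  obtain ⟨C, hC⟩ := hr
  obtain ⟨B, hB, hB'⟩ := exists_penalty_moment_bound M π πref hp hkl
  have hp0 : 0 < p := by linarith
  have hm := measurable_klPenalty π πref
  have hrm := M.measurable_r
  set D : ℝ≥0∞ := 2 ^ (p - 1) * (ENNReal.ofReal C ^ p + B) with hDdef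
  have hD : D < ∞ := ENNReal.mul_lt_top
    (ENNReal.rpow_lt_top_of_nonneg (by linarith) (by simp)) (ENNReal.add_lt_top.2
      ⟨ENNReal.rpow_lt_top_of_nonneg hp0.le ENNReal.ofReal_ne_top, hB⟩)
  have hstep : ∀ xa, ∫⁻ y, ‖M.r y - τ * (klPenalty π πref y.1).toReal‖ₑ ^ p
      ∂(M.stateActionKernel π xa) ≤ D := by
    intro xa
    calc _ ≤ ∫⁻ y, 2 ^ (p - 1) * (ENNReal.ofReal C ^ p +
          (ENNReal.ofReal τ * klPenalty π πref y.1) ^ p) ∂(M.stateActionKernel π xa) := by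
          refine lintegral_mono fun y => ?_
          refine le_trans (ENNReal.rpow_le_rpow (enorm_sub_le.trans (add_le_add
            (enorm_reward_le hC y) (enorm_penalty_le π πref hτ y.1))) hp0.le) ?_
          exact ENNReal.rpow_add_le_mul_rpow_add_rpow _ _ hp
      _ ≤ D := by
          rw [lintegral_const_mul _ (by fun_prop), lintegral_add_left (by fun_prop)]
          simp only [lintegral_const, measure_univ, mul_one]
          rw [hDdef]
          gcongr
          exact hB' xa
  -- `D` bounds a `p`-th moment, so its `p`-th root bounds the norm.
  refine ⟨D ^ p⁻¹, ENNReal.rpow_lt_top_of_nonneg (by positivity) hD.ne, fun xa t => ?_⟩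
  have hterm : (fun ω => M.softReturnTerm π πref τ ω t) = (M.γ ^ (t + 1)) •
      fun ω : ℕ → X × A => M.r (ω (t + 1)) - τ * (klPenalty π πref (ω (t + 1)).1).toReal := rfl
  rw [hterm, eLpNorm_const_smul, enorm_pow, Real.enorm_of_nonneg hγ0]
  gcongr
  rw [eLpNorm_eq_lintegral_rpow_enorm_toReal (by simpa using hp0) ENNReal.ofReal_ne_top,
    ENNReal.toReal_ofReal hp0.le, one_div]
  refine ENNReal.rpow_le_rpow ?_ (by positivity)
  exact lintegral_trajectory_succ_le M π
    (f := fun y => ‖M.r y - τ * (klPenalty π πref y.1).toReal‖ₑ ^ p) (by fun_prop) hstep t xa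

theorem tsum_ofReal_pow_succ_mul_lt_top {γ : ℝ} (hγ1 : γ < 1) {D : ℝ≥0∞} (hD : D < ∞) :
    ∑' t : ℕ, ENNReal.ofReal γ ^ (t + 1) * D < ∞ := by
  rw [ENNReal.tsum_mul_right, ENNReal.tsum_geometric_add_one]
  refine ENNReal.mul_lt_top (ENNReal.mul_lt_top ENNReal.ofReal_lt_top ?_) hD
  rw [ENNReal.inv_lt_top, tsub_pos_iff_lt]
  exact ENNReal.ofReal_lt_one.2 hγ1

/-- The expected sum of absolute values is finite: on a probability space the `L^1` norm is at most
the `L^p` norm, which decays geometrically in `t`. -/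
theorem ae_summable_softReturnTerm (M : DecisionProcess X A)
    (hr : ∃ C : ℝ, ∀ xa, |M.r xa| ≤ C) (hγ0 : 0 ≤ M.γ) (hγ1 : M.γ < 1)
    (π πref : Kernel X A) [IsMarkovKernel π] [IsMarkovKernel πref]
    {p : ℝ} (hp : 1 ≤ p) {τ : ℝ} (hτ : 0 ≤ τ)
    (hkl : ⨆ xa, eLpNorm (fun x' => ENNReal.ofReal τ * klPenalty π πref x')
      (ENNReal.ofReal p) (M.P xa) < ∞) (xa : X × A) :
    ∀ᵐ ω ∂(M.trajectory π xa), Summable (M.softReturnTerm π πref τ ω) := by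
  obtain ⟨D, hD, hD'⟩ := exists_eLpNorm_softReturnTerm_le M hr hγ0 π πref hp hτ hkl
  have hm := measurable_softReturnTerm M π πref τ
  have h1 : ∫⁻ ω, ∑' t, ‖M.softReturnTerm π πref τ ω t‖ₑ ∂(M.trajectory π xa) < ∞ := by
    rw [lintegral_tsum fun t => (hm t).enorm.aemeasurable]
    refine lt_of_le_of_lt (ENNReal.tsum_le_tsum fun t => ?_)
      (tsum_ofReal_pow_succ_mul_lt_top hγ1 hD)
    rw [← eLpNorm_one_eq_lintegral_enorm]
    refine (eLpNorm_le_eLpNorm_of_exponent_le ?_ (hm t).aestronglyMeasurable).trans (hD' xa t)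
    exact ENNReal.one_le_ofReal.2 hp
  filter_upwards [ae_lt_top (Measurable.tsum fun t => (hm t).enorm) h1.ne] with ω hω
  exact Summable.of_nnnorm (ENNReal.tsum_coe_ne_top_iff_summable.1 hω.ne)

theorem softReturnDistribution_mem_momentKernels (M : DecisionProcess X A)
    (hr : ∃ C : ℝ, ∀ xa, |M.r xa| ≤ C) (hγ0 : 0 ≤ M.γ) (hγ1 : M.γ < 1)
    (π πref : Kernel X A) [IsMarkovKernel π] [IsMarkovKernel πref]
    {p : ℝ} (hp : 1 ≤ p) {τ : ℝ} (hτ : 0 ≤ τ)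
    (hkl : ⨆ xa, eLpNorm (fun x' => ENNReal.ofReal τ * klPenalty π πref x')
      (ENNReal.ofReal p) (M.P xa) < ∞) :
    M.softReturnDistribution π πref τ ∈ momentKernels (X × A) p := by
  obtain ⟨D, hD, hD'⟩ := exists_eLpNorm_softReturnTerm_le M hr hγ0 π πref hp hτ hkl
  have hp0 : 0 < p := by linarith
  have hp1 : 1 ≤ ENNReal.ofReal p := ENNReal.one_le_ofReal.2 hp
  have hm := measurable_softReturnTerm M π πref τ
  have hrm := M.measurable_r
  have hS := measurable_softReturn M π πref τ
  have hsum := ae_summable_softReturnTerm M hr hγ0 hγ1 π πref hp hτ hkl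
  obtain ⟨C, hC⟩ := hr
  have hpartial : ∀ xa n, eLpNorm ((fun ω : ℕ → X × A => M.r (ω 0)) +
      ∑ t ∈ Finset.range n, fun ω => M.softReturnTerm π πref τ ω t) (ENNReal.ofReal p)
      (M.trajectory π xa) ≤
        ENNReal.ofReal C + ∑' t : ℕ, ENNReal.ofReal M.γ ^ (t + 1) * D := by
    intro xa n
    refine (eLpNorm_add_le (by fun_prop : Measurable _).aestronglyMeasurable
      (Finset.aestronglyMeasurable_sum _ fun t _ => (hm t).aestronglyMeasurable) hp1).trans
      (add_le_add ?_ ?_)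
    · refine (eLpNorm_le_of_ae_bound (ae_of_all _ fun ω => hC (ω 0))).trans ?_
      simp
    · refine (eLpNorm_sum_le (fun t _ => (hm t).aestronglyMeasurable) hp1).trans ?_
      exact (Finset.sum_le_sum fun t _ => hD' xa t).trans (ENNReal.sum_le_tsum _)
  have hnorm : ∀ xa, eLpNorm (M.softReturn π πref τ) (ENNReal.ofReal p) (M.trajectory π xa) ≤
      ENNReal.ofReal C + ∑' t : ℕ, ENNReal.ofReal M.γ ^ (t + 1) * D := by
    intro xa
    -- Minkowski bounds the partial sums uniformly; Fatou carries the bound to their almost sure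
    -- limit.
    refine (Lp.eLpNorm_lim_le_liminf_eLpNorm (f := fun n => (fun ω : ℕ → X × A => M.r (ω 0)) +
      ∑ t ∈ Finset.range n, fun ω => M.softReturnTerm π πref τ ω t) (fun n => ?_) _ ?_).trans ?_
    · exact (by fun_prop : Measurable fun ω : ℕ → X × A => M.r (ω 0)).aestronglyMeasurable.add
        (Finset.aestronglyMeasurable_sum _ fun t _ => (hm t).aestronglyMeasurable)
    · filter_upwards [hsum xa] with ω hω
      simp only [Pi.add_apply, Finset.sum_apply]
      exact hω.hasSum.tendsto_sum_nat.const_add _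
    · exact (Filter.liminf_le_liminf (Filter.Eventually.of_forall (hpartial xa))).trans
        (Filter.liminf_const _).le
  refine ⟨Kernel.IsMarkovKernel.map _ hS, (iSup_le fun xa => ?_).trans_lt
    (ENNReal.rpow_lt_top_of_nonneg (y := p) hp0.le (ENNReal.add_lt_top.2
      ⟨ENNReal.ofReal_lt_top (r := C), tsum_ofReal_pow_succ_mul_lt_top hγ1 hD⟩).ne)⟩
  rw [softReturnDistribution, Kernel.map_apply _ hS, lintegral_map (by fun_prop) hS]
  refine le_trans ?_ (ENNReal.rpow_le_rpow (hnorm xa) hp0.le)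
  rw [eLpNorm_eq_lintegral_rpow_enorm_toReal (by simpa using hp0) ENNReal.ofReal_ne_top,
    ENNReal.toReal_ofReal hp0.le, one_div, ENNReal.rpow_inv_rpow hp0.ne']

theorem softBellman_softReturnDistribution (M : DecisionProcess X A)
    (π πref : Kernel X A) [IsMarkovKernel π] [IsMarkovKernel πref] (τ : ℝ)
    (hsum : ∀ xa, ∀ᵐ ω ∂(M.trajectory π xa), Summable (M.softReturnTerm π πref τ ω)) :
    M.softBellman π πref τ (M.softReturnDistribution π πref τ) =
      M.softReturnDistribution π πref τ := by
  have hS := measurable_softReturn M π πref τ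
  have hkl := measurable_klPenalty π πref
  have hrm := M.measurable_r
  have hsh := measurable_shiftSeq (E := X × A)
  have : IsMarkovKernel (M.softReturnDistribution π πref τ) := Kernel.IsMarkovKernel.map _ hS
  ext1 xa
  refine Measure.ext_of_lintegral _ fun f hf => ?_
  have happ : ∀ y, M.softReturnDistribution π πref τ y =
      (M.trajectory π y).map (M.softReturn π πref τ) := fun y => Kernel.map_apply _ hS y
  rw [lintegral_softBellman M π πref τ _ xa hf, happ, lintegral_map hf hS]
  -- The next pair `y` is rewritten as `ω 0`, so that the integrand depends on the trajectory alone
  -- and the Markov property applies; then `xa` becomes the initial point of the unshifted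
  -- trajectory, and the recursion for the return closes the chain.
  calc _ = ∫⁻ y, ∫⁻ ω, f (M.r xa + M.γ * M.softReturn π πref τ ω -
        M.γ * τ * (klPenalty π πref (ω 0).1).toReal) ∂(M.trajectory π y)
          ∂(M.stateActionKernel π xa) := by
        refine lintegral_congr fun y => ?_
        rw [happ, lintegral_map (by fun_prop) hS]
        exact (lintegral_trajectory_zero M π y (F := fun y ω =>
          f (M.r xa + M.γ * M.softReturn π πref τ ω -
            M.γ * τ * (klPenalty π πref y.1).toReal)) (by fun_prop)).symm
    _ = ∫⁻ ω, f (M.r xa + M.γ * M.softReturn π πref τ (shiftSeq ω) -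
        M.γ * τ * (klPenalty π πref (shiftSeq ω 0).1).toReal) ∂(M.trajectory π xa) :=
        (lintegral_trajectory_shift M π xa (f := fun ω =>
          f (M.r xa + M.γ * M.softReturn π πref τ ω -
            M.γ * τ * (klPenalty π πref (ω 0).1).toReal)) (by fun_prop)).symm
    _ = ∫⁻ ω, f (M.r (ω 0) + M.γ * M.softReturn π πref τ (shiftSeq ω) -
        M.γ * τ * (klPenalty π πref (shiftSeq ω 0).1).toReal) ∂(M.trajectory π xa) :=
        (lintegral_trajectory_zero M π xa (F := fun y ω =>
          f (M.r y + M.γ * M.softReturn π πref τ (shiftSeq ω) -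
            M.γ * τ * (klPenalty π πref (shiftSeq ω 0).1).toReal)) (by fun_prop)).symm
    _ = _ := lintegral_congr_ae ((hsum xa).mono fun ω hω => by
        simp only [softReturn_eq_shift M π πref τ ω hω])

end DecisionProcess

end

theorem mainTheorem8 {X A : Type*} [MeasurableSpace X] [MeasurableSpace A]
    [MeasurableSpace.CountablyGenerated A]
    (M : DecisionProcess X A)
    (hr : ∃ C : ℝ, ∀ xa, |M.r xa| ≤ C) (hγ0 : 0 ≤ M.γ) (hγ1 : M.γ < 1)
    (π πref : Kernel X A) [IsMarkovKernel π] [IsMarkovKernel πref]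
    (p : ℝ) (hp : 1 ≤ p) (τ : ℝ) (hτ : 0 ≤ τ)
    (hkl : ⨆ xa, eLpNorm (fun x' => ENNReal.ofReal τ * klPenalty π πref x')
      (ENNReal.ofReal p) (M.P xa) < ∞) :
    -- the operator is a `γ`-contraction of the space of kernels with bounded `p`-th moments
    (∀ ζ ∈ momentKernels (X × A) p, M.softBellman π πref τ ζ ∈ momentKernels (X × A) p) ∧
    (∀ ζ ∈ momentKernels (X × A) p, ∀ ζ' ∈ momentKernels (X × A) p,
      supWasserstein p (M.softBellman π πref τ ζ) (M.softBellman π πref τ ζ') ≤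
        ENNReal.ofReal M.γ * supWasserstein p ζ ζ') ∧
    -- the series that defines the soft return converges absolutely, almost surely
    (∀ xa, ∀ᵐ ω ∂(M.trajectory π xa), Summable (M.softReturnTerm π πref τ ω)) ∧
    -- the soft return distribution function is the unique fixed point
    M.softReturnDistribution π πref τ ∈ momentKernels (X × A) p ∧
    M.softBellman π πref τ (M.softReturnDistribution π πref τ) =
      M.softReturnDistribution π πref τ ∧
    (∀ ζ ∈ momentKernels (X × A) p,
      M.softBellman π πref τ ζ = ζ → ζ = M.softReturnDistribution π πref τ) := by
  have hsum := M.ae_summable_softReturnTerm hr hγ0 hγ1 π πref hp hτ hkl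
  have hmem := M.softReturnDistribution_mem_momentKernels hr hγ0 hγ1 π πref hp hτ hkl
  have hfix := M.softBellman_softReturnDistribution π πref τ hsum
  refine ⟨fun ζ hζ => M.softBellman_mem_momentKernels hr hγ0 hγ1 π πref hp hτ hkl hζ,
    fun ζ hζ ζ' hζ' => ?_, hsum, hmem, hfix,
    fun ζ hζ h => M.eq_of_softBellman_eq hγ0 hγ1 π πref hp τ hζ hmem h hfix⟩
  have := hζ.1
  have := hζ'.1
  exact M.supWasserstein_softBellman_le hγ0 π πref hp τ ζ ζ'
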